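/- Identify $P(\mathbb N)$ with the Cantor space $\{0,1\}^{\mathbb N}$ (product topology) via characteristic functions; let $\mathrm{Fin}$ be the set of finite subsets of $\mathbb N$, and let subsets of $P(\mathbb N)$ carry the subspace topology. Covers. A cover of a space $Y$ is a family $\mathcal U$ of subsets of $Y$ with $\bigcup\mathcal U=Y$ and $Y\notin\mathcal U$. It is an $\omega$-cover if every finite subset of $Y$ is contained in a member of $\mathcal U$; a $\tau$-cover if every $y\in Y$ belongs to infinitely many members of $\mathcal U$ and, for all $x,y\in Y$, at least one of $\{U\in\mathcal U: x\in U,\ y\notin U\}$, $\{U\in\mathcal U: y\in U,\ x\notin U\}$ is finite; a $\gamma$-cover if $\mathcal U$ is infinite and every $y\in Y$ belongs to all but finitely many members of $\mathcal U$. Let $\mathcal O$, $\Omega$, $\Gamma$ be the collections of countable open covers, countable open $\omega$-covers and countable open $\gamma$-covers of $Y$. The space $Y$ satisfies $S_1(\Omega,\Gamma)$ if for all $\mathcal U_0,\mathcal U_1,\ldots\in\Omega$ there are $U_n\in\mathcal U_n$ with $\{U_n:n\in\mathbb N\}\in\Gamma$. It satisfies $U_{fin}(\Gamma,\mathcal O)$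 if for all $\mathcal U_0,\mathcal U_1,\ldots\in\Gamma$, none of which contains a finite subcover, there are finite (possibly empty) $\mathcal F_n\subseteq\mathcal U_n$ with $\{\bigcup\mathcal F_n:n\in\mathbb N\}\in\mathcal O$. It is a $\tau$-set if every $\tau$-cover of $Y$ by clopen sets contains a $\gamma$-cover of $Y$. Combinatorics. Write $A\subseteq^* B$ if $A\setminus B$ is finite. A pseudo-intersection of a family $\mathcal F\subseteq P(\mathbb N)$ is an infinite $P\subseteq\mathbb N$ with $P\subseteq^* A$ for all $A\in\mathcal F$. The cardinal $\mathfrak p$ is the least size of a family $\mathcal F\subseteq P(\mathbb N)$ in which every finite subfamily has infinite intersection but which has no pseudo-intersection, and $\mathfrak c=2^{\aleph_0}$. A tower is a family of infinite subsets of $\mathbb N$ with no pseudo-intersection in which every nonempty subfamily $\mathcal S$ has a member $A$ with $B\subseteq^* A$ for all $B\in\mathcal S$. A set $D\subseteq\mathbb N^{\mathbb N}$ is dominating if for every $g\in\mathbb N^{\mathbb N}$ there is $f\in D$ with $g(n)\le f(n)$ for all but finitely many $n$. Theorem. Assume $\mathfrak p=\mathfrak c$. Then there is a set $X\subseteq P(\mathbb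 N)$ with $\mathrm{Fin}\subseteq X$ such that: 1. $X$ satisfies $S_1(\Omega,\Gamma)$ and $X$ is a $\tau$-set; 2. $X\setminus\mathrm{Fin}$ does not satisfy $U_{fin}(\Gamma,\mathcal O)$ and $X\setminus\mathrm{Fin}$ is not a $\tau$-set; 3. $X\setminus\mathrm{Fin}$ is a tower, and the set of increasing enumerations of its members is dominating in $\mathbb N^{\mathbb N}$. -/

import Mathlib

open Set Filter
open scoped Cardinal

namespace SelectionPrinciples

section Covers

variable {X : Type*}

/-- Covers of the space `X`; the whole space is never allowed as a member of a cover. -/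
def IsCover (U : Set (Set X)) : Prop :=
  ⋃₀ U = univ ∧ univ ∉ U

/-- `ω`-covers: each finite subset of `X` is contained in some member of the cover. -/
def IsOmegaCover (U : Set (Set X)) : Prop :=
  IsCover U ∧ ∀ F : Set X, F.Finite → ∃ V ∈ U, F ⊆ V

/-- `τ`-covers: large covers such that for all `x`, `y`, one of the sets
`{V ∈ U | x ∈ V, y ∉ V}`, `{V ∈ U | y ∈ V, x ∉ V}` is finite. -/
def IsTauCover (U : Set (Set X)) : Prop :=
  IsCover U ∧ (∀ x : X, {V ∈ U | x ∈ V}.Infinite) ∧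
    ∀ x y : X, {V ∈ U | x ∈ V ∧ y ∉ V}.Finite ∨ {V ∈ U | y ∈ V ∧ x ∉ V}.Finite

/-- `γ`-covers: infinite covers such that each point belongs to all but finitely many members. -/
def IsGammaCover (U : Set (Set X)) : Prop :=
  IsCover U ∧ U.Infinite ∧ ∀ x : X, {V ∈ U | x ∉ V}.Finite

/-- The selection hypothesis `S₁(𝒜, ℬ)`. -/
def S1 (A B : Set (Set (Set X))) : Prop :=
  ∀ U : ℕ → Set (Set X), (∀ n, U n ∈ A) →
    ∃ V : ℕ → Set X, (∀ n, V n ∈ U n) ∧ range V ∈ B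

/-- The selection hypothesis `U_fin(𝒜, ℬ)`. -/
def Ufin (A B : Set (Set (Set X))) : Prop :=
  ∀ U : ℕ → Set (Set X), (∀ n, U n ∈ A) →
    (∀ n, ¬ ∃ F : Set (Set X), F ⊆ U n ∧ F.Finite ∧ ⋃₀ F = univ) →
    ∃ F : ℕ → Set (Set X), (∀ n, F n ⊆ U n ∧ (F n).Finite) ∧ range (fun n => ⋃₀ F n) ∈ B

end Covers

section Spaces

variable (X : Type*) [TopologicalSpace X]

/-- The collection `𝒪` of countable open covers of `X`. -/
def openCovers : Set (Set (Set X)) :=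
  {U | U.Countable ∧ (∀ V ∈ U, IsOpen V) ∧ IsCover U}

/-- The collection `Ω` of countable open `ω`-covers of `X`. -/
def openOmegaCovers : Set (Set (Set X)) :=
  {U | U.Countable ∧ (∀ V ∈ U, IsOpen V) ∧ IsOmegaCover U}

/-- The collection `Γ` of countable open `γ`-covers of `X`. -/
def openGammaCovers : Set (Set (Set X)) :=
  {U | U.Countable ∧ (∀ V ∈ U, IsOpen V) ∧ IsGammaCover U}

/-- `X` is a `τ`-set: each clopen `τ`-cover of `X` contains a `γ`-cover of `X`. -/
def IsTauSet : Prop :=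
  ∀ U : Set (Set X), (∀ V ∈ U, IsClopen V) → IsTauCover U → ∃ W ⊆ U, IsGammaCover W

end Spaces

/-- `A ⊆* B`: all but finitely many elements of `A` belong to `B`. -/
def AlmostSubset (A B : Set ℕ) : Prop :=
  (A \ B).Finite

/-- `P` is a pseudo-intersection of `F`: an infinite set almost contained in each member. -/
def IsPseudoIntersection (P : Set ℕ) (F : Set (Set ℕ)) : Prop :=
  P.Infinite ∧ ∀ A ∈ F, AlmostSubset P A

/-- `F` is centered: the intersection of each finite subfamily is infinite. -/
def IsCentered (F : Set (Set ℕ)) : Prop :=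
  ∀ G ⊆ F, G.Finite → (⋂₀ G).Infinite

/-- The pseudo-intersection number `𝔭`: the least size of a centered family of sets of
natural numbers which has no pseudo-intersection. -/
noncomputable def pseudoIntersectionNumber : Cardinal.{0} :=
  sInf {κ | ∃ F : Set (Set ℕ), #F = κ ∧ IsCentered F ∧ ¬ ∃ P, IsPseudoIntersection P F}

/-- A tower: a family of infinite sets of natural numbers which is well-ordered by `⊇*`
(modulo finite differences) and has no pseudo-intersection. -/
def IsTower (T : Set (Set ℕ)) : Prop :=
  (∀ A ∈ T, A.Infinite) ∧
    (∀ S ⊆ T, S.Nonempty → ∃ A ∈ S, ∀ B ∈ S, AlmostSubset B A) ∧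
    ¬ ∃ P, IsPseudoIntersection P T

/-- A dominating subset of the Baire space, for the quasiorder `≤*`. -/
def IsDominating (Y : Set (ℕ → ℕ)) : Prop :=
  ∀ g : ℕ → ℕ, ∃ f ∈ Y, ∀ᶠ n in atTop, g n ≤ f n

/-- The subset of `ℕ` whose characteristic function is `x`. In this way the power set of `ℕ`
is identified with the Cantor space `ℕ → Bool`, which carries the product topology. -/
def toSet (x : ℕ → Bool) : Set ℕ :=
  {n | x n = true}

/-- The points of the Cantor space that correspond to the finite sets of natural numbers. -/
def finSets : Set (ℕ → Bool) :=
  {x | (toSet x).Finite}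

/-- The increasing enumeration of the set `A` (used for infinite `A` only). -/
noncomputable def enumeration (A : Set ℕ) : ℕ → ℕ :=
  Nat.nth (fun k => k ∈ A)

end SelectionPrinciples

namespace SelectionPrinciples

/-! Build a `⊇*`-decreasing sequence of infinite sets by recursion along a well-order of all tasks:
matrices of open sets paired with functions `g`. There are at most `𝔠` tasks, and each has fewer
than `𝔠 = 𝔭` predecessors, so a pseudo-intersection `P` of the sets built so far exists. It is
thinned until its enumeration lies above `g` and, if the rows of the matrix are `ω`-covers of the
points present so far, until one choice per row captures those points and every `z ⊆*` the new set
(`exists_subset_selection`). All later sets are such `z`, so the choice made at stage `t` works for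
the final `X`, which consists of `Fin`, the cofinite sets and the sequence. This gives `S₁(Ω, Γ)`;
being a `τ`-set follows because `τ`-covers are `ω`-covers and these have countable `ω`-subcovers.

Without `Fin`, the functions `g` make the enumerations dominating, hence the family has no
pseudo-intersection. Domination refutes `U_fin(Γ, 𝒪)`, and the tower refutes the `τ`-property. The
cofinite sets keep the witnessing covers free of the whole space. -/

theorem toSet_injective : Function.Injective toSet := by
  intro x y h
  funext n
  have : n ∈ toSet x ↔ n ∈ toSet y := by rw [h]
  simp only [toSet, mem_ofPred_eq] at this
  exact Bool.eq_iff_iff.mpr this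

theorem toSet_surjective : Function.Surjective toSet := by
  classical
  intro A
  exact ⟨fun n => decide (n ∈ A), by ext; simp [toSet]⟩

theorem AlmostSubset.refl (A : Set ℕ) : AlmostSubset A A := by
  simp [AlmostSubset]

theorem AlmostSubset.trans {A B C : Set ℕ} (h : AlmostSubset A B) (h' : AlmostSubset B C) :
    AlmostSubset A C := by
  refine (h.union h').subset ?_
  rintro n ⟨h1, h2⟩
  by_cases h3 : n ∈ B
  · exact Or.inr ⟨h3, h2⟩
  · exact Or.inl ⟨h1, h3⟩

theorem AlmostSubset.of_subset {A B : Set ℕ} (h : A ⊆ B) : AlmostSubset A B := by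
  simp [AlmostSubset, sdiff_eq_empty.mpr h]

/-! ### Selections from `ω`-covers through pseudo-intersections -/

/-- Families of size less than `𝔭` with the strong finite intersection property have
pseudo-intersections; the indexed form. -/
theorem exists_pseudoIntersection {ι : Type} (hι : #ι < pseudoIntersectionNumber)
    (φ : ι → Set ℕ) (h : ∀ s : Finset ι, {n | ∀ i ∈ s, n ∈ φ i}.Infinite) :
    ∃ P : Set ℕ, P.Infinite ∧ ∀ i, AlmostSubset P (φ i) := by
  classical
  by_contra hcon
  have hle : pseudoIntersectionNumber ≤ #(range φ) := by
    refine csInf_le' ⟨range φ, rfl, ?_, ?_⟩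
    · intro G hG hGf
      obtain ⟨s, -, hs, rfl⟩ := Set.exists_subset_image_finite_and.1
        ⟨G, (image_univ (f := φ)).symm ▸ hG, hGf, rfl⟩
      refine (h hs.toFinset).mono ?_
      rintro n hn _ ⟨i, hi, rfl⟩
      exact hn i (hs.mem_toFinset.2 hi)
    · rintro ⟨P, hP, hPF⟩
      exact hcon ⟨P, hP, fun i => hPF _ ⟨i, rfl⟩⟩
  exact absurd (hle.trans Cardinal.mk_range_le) (not_le.2 hι)

/-- The points which lie in the sets that the list `l` selects from the first `l.length` rows
of `U`. -/
def selected (U : ℕ → ℕ → Set (ℕ → Bool)) (l : List ℕ) : Set (ℕ → Bool) :=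
  {z | ∀ i < l.length, z ∈ U i (l.getD i 0)}

theorem isOpen_selected {U : ℕ → ℕ → Set (ℕ → Bool)} (hU : ∀ n m, IsOpen (U n m)) (l : List ℕ) :
    IsOpen (selected U l) := by
  have : selected U l = ⋂ i ∈ Finset.range l.length, U i (l.getD i 0) := by
    ext z; simp [selected]
  rw [this]
  exact isOpen_biInter_finset fun i _ => hU _ _

/-- The rows of `U` are `ω`-covers of `Y`. -/
def RowsOmegaCover (U : ℕ → ℕ → Set (ℕ → Bool)) (Y : Set (ℕ → Bool)) : Prop :=
  ∀ n, ∀ F ⊆ Y, F.Finite → ∃ m, F ⊆ U n m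

/-- A list codes a choice from finitely many rows. The sets "`selected U l` contains `y`" and "`l`
has length at least `k`" form a centered family of fewer than `𝔭` subsets of the countable set of
lists; `P` is a pseudo-intersection. -/
theorem exists_infinite_selections (hpc : pseudoIntersectionNumber = 𝔠)
    {U : ℕ → ℕ → Set (ℕ → Bool)} {Y : Set (ℕ → Bool)} (hY : #Y < 𝔠) (hUY : RowsOmegaCover U Y) :
    ∃ P : Set (List ℕ), P.Infinite ∧ (∀ k, {l ∈ P | l.length < k}.Finite) ∧
      ∀ y ∈ Y, {l ∈ P | y ∉ selected U l}.Finite := by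
  classical
  let L : ℕ ≃ List ℕ := (Denumerable.eqv (List ℕ)).symm
  let φ : Y ⊕ ℕ → Set ℕ :=
    Sum.elim (fun y => {t | (y : ℕ → Bool) ∈ selected U (L t)}) (fun k => {t | k ≤ (L t).length})
  have hcard : #(Y ⊕ ℕ) < pseudoIntersectionNumber := by
    rw [hpc, Cardinal.mk_sum, Cardinal.lift_id, Cardinal.lift_id, Cardinal.mk_nat]
    exact Cardinal.add_lt_of_lt Cardinal.aleph0_le_continuum hY Cardinal.aleph0_lt_continuum
  obtain ⟨P, hP, hPφ⟩ := exists_pseudoIntersection hcard φ (by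
    intro s
    let F : Set (ℕ → Bool) := {z | ∃ h : z ∈ Y, Sum.inl ⟨z, h⟩ ∈ s}
    have hF : F.Finite := by
      refine ((s.finite_toSet.preimage (f := (Sum.inl : Y → Y ⊕ ℕ))
        Sum.inl_injective.injOn).image Subtype.val).subset ?_
      rintro z ⟨h, hz⟩
      exact ⟨⟨z, h⟩, hz, rfl⟩
    have hK : ∃ K, ∀ k, Sum.inr k ∈ s → k ≤ K := by
      obtain ⟨K, hK⟩ := (s.finite_toSet.preimage (f := (Sum.inr : ℕ → Y ⊕ ℕ))
        Sum.inr_injective.injOn).bddAbove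
      exact ⟨K, fun k hk => hK hk⟩
    obtain ⟨K, hK⟩ := hK
    choose m hm using fun n => hUY n F (fun z hz => hz.1) hF
    refine Set.Infinite.of_image (fun t => (L t).length) (Set.infinite_of_forall_exists_gt ?_)
    intro n
    -- `K` meets the length demands in `s`; `n` makes such lists arbitrarily long, so there are
    -- infinitely many.
    let l : List ℕ := List.ofFn (fun i : Fin (max n K + 1) => m i)
    have hl : l.length = max n K + 1 := by simp [l]
    refine ⟨l.length, ⟨L.symm l, ?_, by simp⟩, by omega⟩
    rintro (y | k) hi
    · simp only [φ, Sum.elim_inl, mem_ofPred_eq, Equiv.apply_symm_apply]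
      intro i hil
      have : l.getD i 0 = m i := by
        rw [List.getD_eq_getElem _ _ hil]
        simp only [l, List.getElem_ofFn]
      rw [this]
      exact hm i ⟨y.2, hi⟩
    · simp only [φ, Sum.elim_inr, mem_ofPred_eq, Equiv.apply_symm_apply]
      have := hK k hi
      omega)
  refine ⟨L '' P, hP.image L.injective.injOn, fun k => ?_, fun y hy => ?_⟩
  · refine ((hPφ (Sum.inr k)).image L).subset ?_
    rintro _ ⟨⟨t, ht, rfl⟩, h⟩
    exact ⟨t, ⟨ht, by simpa [φ] using h⟩, rfl⟩
  · refine ((hPφ (Sum.inl ⟨y, hy⟩)).image L).subset ?_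
    rintro _ ⟨⟨t, ht, rfl⟩, h⟩
    exact ⟨t, ⟨ht, by simpa [φ] using h⟩, rfl⟩

theorem eventually_cylinder_subset {G : Set (ℕ → Bool)} (hG : IsOpen G) {x : ℕ → Bool}
    (hx : x ∈ G) : ∀ᶠ N in atTop, ∀ z : ℕ → Bool, (∀ n < N, z n = x n) → z ∈ G := by
  obtain ⟨I, u, hu, hIG⟩ := isOpen_pi_iff.1 hG x hx
  filter_upwards [eventually_gt_atTop (I.sup id)] with N hN z hz
  refine hIG fun i hi => ?_
  rw [hz i ((Finset.le_sup (f := id) hi).trans_lt hN)]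
  exact (hu i hi).2

theorem finite_setOf_bounded_support (b : ℕ) :
    {x : ℕ → Bool | ∀ n, b < n → x n = false}.Finite := by
  refine Set.Finite.of_finite_image (f := toSet) ((Set.finite_Iic b).finite_subsets.subset ?_)
    toSet_injective.injOn
  rintro _ ⟨x, hx, rfl⟩ n hn
  by_contra h
  simp [hx n (by simpa using h), toSet] at hn

/-- An open set containing all subsets of `[0, b]` contains all sets that
miss a long enough interval after `b`. -/
theorem eventually_gap_subset {G : Set (ℕ → Bool)} (hG : IsOpen G) {b : ℕ}
    (hb : ∀ x : ℕ → Bool, (∀ n, b < n → x n = false) → x ∈ G) :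
    ∀ᶠ N in atTop, ∀ z : ℕ → Bool, (∀ n, b < n → n < N → z n = false) → z ∈ G := by
  have h := (finite_setOf_bounded_support b).eventually_all (l := atTop)
    (p := fun x N => ∀ z : ℕ → Bool, (∀ n < N, z n = x n) → z ∈ G) |>.2
    fun x hx => eventually_cylinder_subset hG (hb x hx)
  filter_upwards [h] with N hN z hz
  refine hN (fun n => if n ≤ b then z n else false)
    (fun n hn => if_neg (not_le.2 hn)) z fun n hn => ?_
  split_ifs with h1
  · rfl
  · exact hz n (not_le.1 h1) hn

/-- If the rows of `U` are open `ω`-covers of `Y ⊇ Fin` and `#Y < 𝔭`, then one set can be chosen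
from each row such that almost all of them contain any given point of `Y`, and any given subset
(modulo finite) of a suitable infinite `b ⊆ a`. -/
theorem exists_subset_selection (hpc : pseudoIntersectionNumber = 𝔠)
    {U : ℕ → ℕ → Set (ℕ → Bool)} (hU : ∀ n m, IsOpen (U n m))
    {Y : Set (ℕ → Bool)} (hY : #Y < 𝔠) (hfin : finSets ⊆ Y) (hUY : RowsOmegaCover U Y)
    {a : Set ℕ} (ha : a.Infinite) :
    ∃ b ⊆ a, b.Infinite ∧ ∃ f : ℕ → ℕ, ∀ z, (z ∈ Y ∨ AlmostSubset (toSet z) b) →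
      ∀ᶠ n in atTop, z ∈ U n (f n) := by
  classical
  obtain ⟨P, hP, hPlen, hPY⟩ := exists_infinite_selections hpc hY hUY
  -- From `(l, b)`, pick a longer list in `P` whose selection contains all subsets of `[0, b]`, then
  -- the next element of the new set, so far out that only the gap after `b` matters.
  have step : ∀ s : List ℕ × ℕ, ∃ t : List ℕ × ℕ, t.1 ∈ P ∧ s.1.length < t.1.length ∧
      t.2 ∈ a ∧ s.2 < t.2 ∧
      ∀ z : ℕ → Bool, (∀ n, s.2 < n → n < t.2 → z n = false) → z ∈ selected U t.1 := by
    rintro ⟨l, b⟩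
    have hbad : ({l' ∈ P | l'.length < l.length + 1} ∪
        ⋃ x ∈ {x : ℕ → Bool | ∀ n, b < n → x n = false}, {l' ∈ P | x ∉ selected U l'}).Finite := by
      refine (hPlen _).union ((finite_setOf_bounded_support b).biUnion fun x hx => hPY x (hfin ?_))
      refine (Set.finite_Iic b).subset fun n hn => ?_
      by_contra h
      simp [hx n (by simpa using h), toSet] at hn
    obtain ⟨l', hl'P, hl'⟩ := hP.exists_notMem_finite hbad
    simp only [mem_union, mem_iUnion, mem_ofPred_eq, not_or, not_and, not_lt, not_exists,
      not_not] at hl'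
    obtain ⟨N, hN⟩ := (eventually_gap_subset (isOpen_selected hU l')
      (fun x hx => hl'.2 x hx hl'P)).exists_forall_of_atTop
    obtain ⟨b', hb'a, hb'⟩ := ha.exists_gt (max b N)
    exact ⟨(l', b'), hl'P, hl'.1 hl'P, hb'a, by simp; omega, hN b' (by omega)⟩
  choose nxt hnxt using step
  obtain ⟨b0, hb0⟩ := ha.nonempty
  let s : ℕ → List ℕ × ℕ := fun k => nxt^[k] ([], b0)
  have hs : ∀ k, s (k + 1) = nxt (s k) := fun k => Function.iterate_succ_apply' _ _ _
  have hmono : StrictMono fun k => (s k).2 := strictMono_nat_of_lt_succ fun k => by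
    rw [hs]; exact (hnxt _).2.2.2.1
  have hlen : StrictMono fun k => (s k).1.length := strictMono_nat_of_lt_succ fun k => by
    rw [hs]; exact (hnxt _).2.1
  refine ⟨range fun k => (s k).2, ?_, infinite_range_of_injective hmono.injective,
    -- The list at stage `i + 1` has length at least `i + 1`, so entry `i` is never the default `0`.
    fun i => (s (i + 1)).1.getD i 0, fun z hz => ?_⟩
  · rintro _ ⟨k, rfl⟩
    cases k with
    | zero => exact hb0
    | succ k => simp only [hs]; exact (hnxt _).2.2.1
  · have key : ∀ᶠ k in atTop, z ∈ selected U (s (k + 1)).1 := by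
      rcases hz with hz | hz
      · have hinj : Function.Injective fun k => (s (k + 1)).1 := fun i j hij => by
          have := hlen.injective (a₁ := i + 1) (a₂ := j + 1) (congrArg List.length hij)
          omega
        have := ((hPY z hz).preimage (f := fun k => (s (k + 1)).1) hinj.injOn)
        rw [← Nat.cofinite_eq_atTop]
        refine this.subset fun k hk => ⟨?_, hk⟩
        simp only [hs]; exact (hnxt _).1
      · obtain ⟨j, hj⟩ := hz.bddAbove
        -- Beyond its finitely many exceptions, `z` has no element strictly between consecutive
        -- elements of the new set.
        filter_upwards [eventually_ge_atTop j] with k hk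
        rw [hs]
        refine (hnxt (s k)).2.2.2.2 z fun n hn hn' => ?_
        by_contra hzn
        have hkn : k ≤ (s k).2 := hmono.le_apply
        have hnz : n ∈ toSet z := by simpa [toSet] using hzn
        by_cases hr : n ∈ range fun k => (s k).2
        · obtain ⟨i, rfl⟩ := hr
          rw [← hs] at hn'
          have h1 := hmono.lt_iff_lt.1 hn
          have h2 := hmono.lt_iff_lt.1 hn'
          omega
        · have := hj ⟨hnz, hr⟩
          omega
    filter_upwards [key] with i hi
    have : i + 1 ≤ (s (i + 1)).1.length := hlen.le_apply
    exact hi i (by omega)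

/-! ### Increasing enumerations and chains modulo finite sets -/

theorem enumeration_strictMono {A : Set ℕ} (hA : A.Infinite) : StrictMono (enumeration A) :=
  Nat.nth_strictMono (p := fun k => k ∈ A) hA

theorem enumeration_mem {A : Set ℕ} (hA : A.Infinite) (n : ℕ) : enumeration A n ∈ A :=
  Nat.nth_mem_of_infinite (p := fun k => k ∈ A) hA n

theorem enumeration_le {A : Set ℕ} {f : ℕ → ℕ} (hf : StrictMono f) (h : ∀ n, f n ∈ A) (n : ℕ) :
    enumeration A n ≤ f n :=
  Nat.nth_le_of_strictMonoOn_of_mapsTo (p := fun k => k ∈ A) f (fun k _ => h k) (hf.strictMonoOn _)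

theorem enumeration_le_iff {A : Set ℕ} (hA : A.Infinite) [DecidablePred (fun k => k ∈ A)]
    (n m : ℕ) : enumeration A n ≤ m ↔ n < Nat.count (fun k => k ∈ A) (m + 1) := by
  rw [Nat.lt_nth_iff_count_lt (p := fun k => k ∈ A) hA, Nat.lt_succ_iff]
  rfl

/-- Passing to an infinite subset only raises the enumeration, so the bound survives the later
thinning by `exists_subset_selection`. -/
theorem exists_subset_enumeration_ge {a : Set ℕ} (ha : a.Infinite) (g : ℕ → ℕ) :
    ∃ b ⊆ a, b.Infinite ∧ ∀ c ⊆ b, c.Infinite → ∀ n, g n ≤ enumeration c n := by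
  obtain ⟨f, hf, hfa⟩ := extraction_forall_of_frequently
    (P := fun n k => k ∈ a ∧ g n ≤ k) fun n =>
      (Nat.frequently_atTop_iff_infinite.2 ha).and_eventually (eventually_ge_atTop (g n))
  have hb : (range f).Infinite := infinite_range_of_injective hf.injective
  refine ⟨range f, range_subset_iff.2 fun n => (hfa n).1, hb, fun c hc hci n => ?_⟩
  have h1 : f n ≤ enumeration (range f) n :=
    Nat.le_nth_of_monotoneOn_of_surjOn (p := fun k => k ∈ range f) f
      (by rintro _ ⟨k, rfl⟩; exact ⟨k, fun h => absurd h hb, rfl⟩)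
      (hf.monotone.monotoneOn _) (fun h => absurd h hb)
  exact ((hfa n).2.trans h1).trans
    (enumeration_le (enumeration_strictMono hci) (fun k => hc (enumeration_mem hci k)) n)

/-- Finitely many infinite sets which form a chain modulo finite sets have infinite
intersection. -/
theorem infinite_inter_of_chain {ι α : Type*} {φ : ι → Set α} (hφ : ∀ i, (φ i).Infinite)
    (hc : ∀ i j, (φ i \ φ j).Finite ∨ (φ j \ φ i).Finite) {s : Finset ι} (hs : s.Nonempty) :
    {n | ∀ i ∈ s, n ∈ φ i}.Infinite := by
  classical
  have hmin : ∃ i ∈ s, ∀ j ∈ s, (φ i \ φ j).Finite := by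
    induction hs using Finset.Nonempty.cons_induction with
    | singleton i => exact ⟨i, by simp, by simp⟩
    | cons i s hi hs ih =>
      obtain ⟨j, hj, hjs⟩ := ih
      rcases hc i j with h | h
      · refine ⟨i, by simp, fun k hk => ?_⟩
        rcases Finset.mem_cons.1 hk with rfl | hk
        · simp
        · refine (h.union (hjs k hk)).subset ?_
          rintro n ⟨h1, h2⟩
          by_cases h3 : n ∈ φ j
          · exact Or.inr ⟨h3, h2⟩
          · exact Or.inl ⟨h1, h3⟩
      · refine ⟨j, by simp [hj], fun k hk => ?_⟩
        rcases Finset.mem_cons.1 hk with rfl | hk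
        · exact h
        · exact hjs k hk
  obtain ⟨i, -, hi⟩ := hmin
  refine ((hφ i).sdiff (s.finite_toSet.biUnion hi)).mono ?_
  rintro n ⟨h1, h2⟩ j hj
  by_contra h
  exact h2 (mem_biUnion (x := j) hj ⟨h1, h⟩)

/-! ### `τ`-, `ω`- and `γ`-covers -/

section Tau

variable {X : Type*}

/-- The families of members containing a given point are infinite and form a chain modulo finite
sets, so finitely many of them have a common member. -/
theorem IsTauCover.isOmegaCover [Nonempty X] {U : Set (Set X)} (hU : IsTauCover U) :
    IsOmegaCover U := by
  classical
  refine ⟨hU.1, fun F hF => ?_⟩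
  obtain ⟨x⟩ := ‹Nonempty X›
  have h := infinite_inter_of_chain (φ := fun x : X => {V ∈ U | x ∈ V}) hU.2.1
    (fun x y => (hU.2.2 x y).imp
      (fun h => h.subset fun V hV => ⟨hV.1.1, hV.1.2, fun h => hV.2 ⟨hV.1.1, h⟩⟩)
      (fun h => h.subset fun V hV => ⟨hV.1.1, hV.1.2, fun h => hV.2 ⟨hV.1.1, h⟩⟩))
    -- The extra point covers the case of empty `F`.
    (s := insert x hF.toFinset) (Finset.insert_nonempty _ _)
  obtain ⟨V, hV⟩ := h.nonempty
  exact ⟨V, (hV x (by simp)).1, fun y hy => (hV y (by simp [hy])).2⟩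

variable [TopologicalSpace X]

/-- Second countable spaces have the Lindelöf property for `ω`-covers. -/
theorem IsOmegaCover.exists_countable_subcover [SecondCountableTopology X] {U : Set (Set X)}
    (hU : IsOmegaCover U) (ho : ∀ V ∈ U, IsOpen V) : ∃ W ⊆ U, W.Countable ∧ IsOmegaCover W := by
  -- Finite sets are treated as points of the powers `X ^ n`, where the Lindelöf property applies to
  -- the open sets `V ^ n`.
  have h : ∀ n : ℕ, ∃ T : Set U, T.Countable ∧
      ⋃ V ∈ T, (univ : Set (Fin n)).pi (fun _ => (V : Set X)) =
        ⋃ V : U, (univ : Set (Fin n)).pi (fun _ => (V : Set X)) := fun n =>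
    TopologicalSpace.isOpen_iUnion_countable _ fun V =>
      isOpen_set_pi finite_univ fun _ _ => ho _ V.2
  choose T hTc hT using h
  have hW : ∀ F : Set X, F.Finite → ∃ V ∈ ⋃ n, Subtype.val '' T n, F ⊆ V := by
    intro F hF
    obtain ⟨n, f, rfl⟩ := hF.fin_embedding
    obtain ⟨V, hVU, hV⟩ := hU.2 _ hF
    have : (f : Fin n → X) ∈ ⋃ V : U, (univ : Set (Fin n)).pi (fun _ => (V : Set X)) :=
      mem_iUnion.2 ⟨⟨V, hVU⟩, fun i _ => hV ⟨i, rfl⟩⟩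
    rw [← hT n] at this
    obtain ⟨V', hV', hfV⟩ := mem_iUnion₂.1 this
    exact ⟨V', mem_iUnion.2 ⟨n, V', hV', rfl⟩, range_subset_iff.2 fun i => hfV i trivial⟩
  have hsub : (⋃ n, Subtype.val '' T n) ⊆ U := iUnion_subset fun n => by
    rintro _ ⟨V, -, rfl⟩
    exact V.2
  refine ⟨_, hsub, countable_iUnion fun n => (hTc n).image _, ⟨?_, fun h => hU.1.2 (hsub h)⟩, hW⟩
  refine eq_univ_of_forall fun x => ?_
  obtain ⟨V, hV, hx⟩ := hW {x} (finite_singleton x)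
  exact ⟨V, hV, hx rfl⟩

theorem isTauSet_of_S1 [SecondCountableTopology X] [Nonempty X]
    (h : S1 (openOmegaCovers X) (openGammaCovers X)) : IsTauSet X := by
  intro U hclopen hU
  obtain ⟨W, hWU, hWc, hW⟩ :=
    hU.isOmegaCover.exists_countable_subcover fun V hV => (hclopen V hV).isOpen
  obtain ⟨V, hV, hVγ⟩ := h (fun _ => W) fun _ => ⟨hWc, fun V hV => (hclopen V (hWU hV)).isOpen, hW⟩
  exact ⟨range V, range_subset_iff.2 fun n => hWU (hV n), hVγ.2.2⟩

/-- A sequence of proper open sets such that each point is in almost all of them enumerates a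
`γ`-cover. -/
theorem range_mem_openGammaCovers {V : ℕ → Set X} (ho : ∀ n, IsOpen (V n)) (hne : ∀ n, V n ≠ univ)
    (h : ∀ x, ∀ᶠ n in atTop, x ∈ V n) : range V ∈ openGammaCovers X := by
  refine ⟨countable_range V, forall_mem_range.2 ho, ⟨?_, ?_⟩, fun hfin => ?_, fun x => ?_⟩
  · refine eq_univ_of_forall fun x => ?_
    obtain ⟨n, hn⟩ := (h x).exists
    exact ⟨V n, ⟨n, rfl⟩, hn⟩
  · rintro ⟨n, hn⟩
    exact hne n hn
  -- With a finite range some value recurs infinitely often; it then contains every point, against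
  -- properness.
  · obtain ⟨W, ⟨k, rfl⟩, hk⟩ : ∃ W ∈ range V, ∃ᶠ n in atTop, V n = W := by
      by_contra! hcon
      have : ∀ᶠ n in atTop, ∀ W ∈ range V, V n ≠ W :=
        hfin.eventually_all.2 fun W hW => hcon W hW
      obtain ⟨n, hn⟩ := this.exists
      exact hn _ ⟨n, rfl⟩ rfl
    refine hne k (eq_univ_of_forall fun x => ?_)
    obtain ⟨n, hn, hx⟩ := (hk.and_eventually (h x)).exists
    exact hn ▸ hx
  · have hx := h x
    rw [← Nat.cofinite_eq_atTop] at hx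
    refine (Set.Finite.image V hx).subset ?_
    rintro _ ⟨⟨n, rfl⟩, hn⟩
    exact ⟨n, hn, rfl⟩

end Tau

/-! ### Dominating families and towers as counterexamples -/

section Towers

variable {T : Set (ℕ → Bool)}

/-- If `P ⊆* A`, then the enumeration of `A` is bounded by a shift of that of `P`, and `n ↦
enumeration P (2 * n) + 1` eventually exceeds every such shift. -/
theorem IsDominating.not_exists_pseudoIntersection
    (hdom : IsDominating ((fun x => enumeration (toSet x)) '' T)) :
    ¬ ∃ P, IsPseudoIntersection P (toSet '' T) := by
  rintro ⟨P, hP, hPT⟩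
  obtain ⟨_, ⟨x, hx, rfl⟩, hgx⟩ := hdom fun n => enumeration P (2 * n) + 1
  obtain ⟨k, hk⟩ := (hPT _ ⟨x, hx, rfl⟩).bddAbove
  have hmono := enumeration_strictMono hP
  have hle : ∀ n, enumeration (toSet x) n ≤ enumeration P (n + (k + 1)) := by
    refine enumeration_le (fun i j hij => hmono (by omega)) fun n => ?_
    by_contra hn
    have h1 := hk ⟨enumeration_mem hP _, hn⟩
    have h2 : n + (k + 1) ≤ enumeration P (n + (k + 1)) := hmono.le_apply
    omega
  obtain ⟨n, hn, hkn⟩ := (hgx.and (eventually_ge_atTop (k + 1))).exists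
  have h1 := hle n
  have h2 := hmono.monotone (show n + (k + 1) ≤ 2 * n by omega)
  simp only at hn
  omega

/-- Membership depends only on the coordinates `0, …, m`. -/
theorem isOpen_setOf_enumeration_le (hinf : ∀ x ∈ T, (toSet x).Infinite) (n m : ℕ) :
    IsOpen {x : T | enumeration (toSet x.1) n ≤ m} := by
  classical
  refine isOpen_iff_mem_nhds.2 fun x hx => ?_
  have hopen : IsOpen {y : T | ∀ i ∈ Finset.range (m + 1), y.1 i = x.1 i} := by
    have : {y : T | ∀ i ∈ Finset.range (m + 1), y.1 i = x.1 i} =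
        ⋂ i ∈ Finset.range (m + 1), (fun y : T => y.1 i) ⁻¹' {x.1 i} := by
      ext y; simp
    rw [this]
    exact isOpen_biInter_finset fun i _ => (isOpen_discrete _).preimage ((continuous_apply _).comp continuous_subtype_val)
  filter_upwards [hopen.mem_nhds fun i _ => rfl] with y hy
  have hx' := (enumeration_le_iff (hinf x x.2) n m).1 hx
  refine (enumeration_le_iff (hinf y y.2) n m).2 (hx'.trans_eq ?_)
  rw [Nat.count_eq_card_filter_range, Nat.count_eq_card_filter_range]
  congr 1
  refine Finset.filter_congr fun i hi => ?_
  simp [toSet, hy i hi]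

/-- A dominating family of infinite sets which contains all cofinite sets does not satisfy
`U_fin(Γ, 𝒪)`. -/
theorem not_Ufin_of_isDominating (hinf : ∀ x ∈ T, (toSet x).Infinite)
    (hcof : ∀ x, (toSet x)ᶜ.Finite → x ∈ T)
    (hdom : IsDominating ((fun x => enumeration (toSet x)) '' T)) :
    ¬ Ufin (openGammaCovers T) (openCovers T) := by
  intro hU
  let W : ℕ → ℕ → Set T := fun n m => {x | enumeration (toSet x.1) n ≤ m}
  have hWmono : ∀ n, Monotone (W n) := fun n m m' h x hx => le_trans hx h
  have hWne : ∀ n m, W n m ≠ univ := by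
    intro n m h
    obtain ⟨x, hx⟩ := toSet_surjective (Ioi m)
    have hxT : x ∈ T := hcof x (by rw [hx, compl_Ioi]; exact finite_Iic m)
    have h1 : (⟨x, hxT⟩ : T) ∈ W n m := h ▸ mem_univ _
    have h2 := enumeration_mem (hinf x hxT) n
    rw [hx] at h2
    simp only [W, mem_ofPred_eq, hx] at h1
    exact absurd h1 (not_le.2 h2)
  have hbound : ∀ n, ∀ F ⊆ range (W n), F.Finite → ∃ m, ⋃₀ F ⊆ W n m := by
    intro n F hF hFf
    obtain ⟨s, -, hs, rfl⟩ := Set.exists_subset_image_finite_and.1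
      ⟨F, (image_univ (f := W n)).symm ▸ hF, hFf, rfl⟩
    obtain ⟨m, hm⟩ := hs.bddAbove
    refine ⟨m, sUnion_subset ?_⟩
    rintro _ ⟨i, hi, rfl⟩
    exact hWmono n (hm hi)
  have hfinite : ∀ n, ¬ ∃ F : Set (Set T), F ⊆ range (W n) ∧ F.Finite ∧ ⋃₀ F = univ := by
    rintro n ⟨F, hF, hFf, hFu⟩
    obtain ⟨m, hm⟩ := hbound n F hF hFf
    exact hWne n m (univ_subset_iff.1 (hFu ▸ hm))
  have hΓ : ∀ n, range (W n) ∈ openGammaCovers T := fun n =>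
    range_mem_openGammaCovers (isOpen_setOf_enumeration_le hinf n) (hWne n) fun x =>
      eventually_ge_atTop (enumeration (toSet x.1) n)
  -- A cover may catch a point only once, so the principle is applied to every tail of the sequence:
  -- the tail from `J` catches the point at an index where domination already holds.
  choose F hF hFcov using fun k => hU (fun n => range (W (k + n))) (fun n => hΓ _)
    fun n => hfinite _
  choose h hh using fun k n => hbound (k + n) (F k n) (hF k n).1 (hF k n).2
  obtain ⟨_, ⟨x, hx, rfl⟩, hgx⟩ := hdom fun j =>
    (Finset.range (j + 1)).sup (fun k => h k (j - k)) + 1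
  obtain ⟨J, hJ⟩ := hgx.exists_forall_of_atTop
  have hxc : (⟨x, hx⟩ : T) ∈ ⋃₀ range (fun n => ⋃₀ F J n) := by
    rw [(hFcov J).2.2.1]; trivial
  obtain ⟨_, ⟨n, rfl⟩, hxn⟩ := hxc
  have h1 : enumeration (toSet x) (J + n) ≤ h J n := hh J n hxn
  have h2 := hJ (J + n) (by omega)
  have h3 := Finset.le_sup (f := fun k => h k (J + n - k))
    (show J ∈ Finset.range (J + n + 1) by simp)
  simp only [Nat.add_sub_cancel_left] at h2 h3
  omega

/-- A tower which contains all cofinite sets is not a `τ`-set. -/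
theorem not_isTauSet_of_isTower (hT : IsTower (toSet '' T))
    (hcof : ∀ x, (toSet x)ᶜ.Finite → x ∈ T) : ¬ IsTauSet T := by
  intro hτ
  -- The complements of singletons make these sets proper and distinct, so a `γ`-subcover is indexed
  -- by an infinite set of naturals, which is a pseudo-intersection.
  let O : ℕ → Set T := fun n => {x | n ∈ toSet x.1}
  have hpt : ∀ n, ∃ x : T, ∀ m, x ∈ O m ↔ m ≠ n := by
    intro n
    obtain ⟨x, hx⟩ := toSet_surjective {n}ᶜ
    exact ⟨⟨x, hcof x (by simp [hx])⟩, fun m => by simp [O, hx]⟩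
  have hO : Function.Injective O := by
    intro n m hnm
    by_contra hne
    obtain ⟨x, hx⟩ := hpt n
    exact (hx n).1 (hnm ▸ (hx m).2 (Ne.symm hne)) rfl
  have hclopen : ∀ V ∈ range O, IsClopen V := by
    rintro _ ⟨n, rfl⟩
    exact (isClopen_discrete {true}).preimage (f := fun x : T => x.1 n) ((continuous_apply _).comp continuous_subtype_val)
  have hinf : ∀ x : T, (toSet x.1).Infinite := fun x => hT.1 _ ⟨x, x.2, rfl⟩
  have hdiff : ∀ x y : T, AlmostSubset (toSet x.1) (toSet y.1) →
      {V ∈ range O | x ∈ V ∧ y ∉ V}.Finite := by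
    intro x y h
    refine (Set.Finite.image O h).subset ?_
    rintro _ ⟨⟨n, rfl⟩, h1, h2⟩
    exact ⟨n, ⟨h1, h2⟩, rfl⟩
  have hcover : IsTauCover (range O) := by
    refine ⟨⟨eq_univ_of_forall fun x => ?_, ?_⟩, fun x => ?_, fun x y => ?_⟩
    · obtain ⟨n, hn⟩ := (hinf x).nonempty
      exact ⟨O n, ⟨n, rfl⟩, hn⟩
    · rintro ⟨n, hn⟩
      obtain ⟨x, hx⟩ := hpt n
      exact (hx n).1 (hn ▸ mem_univ x) rfl
    · refine ((hinf x).image hO.injOn).mono ?_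
      rintro _ ⟨n, hn, rfl⟩
      exact ⟨⟨n, rfl⟩, hn⟩
    · obtain ⟨A, hA, hAS⟩ := hT.2.1 {toSet x.1, toSet y.1}
        (by rintro _ (rfl | rfl) <;> exact mem_image_of_mem _ (Subtype.mem _)) (by simp)
      rcases hA with rfl | rfl
      · exact Or.inr (hdiff y x (hAS _ (by simp)))
      · exact Or.inl (hdiff x y (hAS _ (by simp)))
  obtain ⟨W, hWO, hW⟩ := hτ _ hclopen hcover
  refine hT.2.2 ⟨O ⁻¹' W, hW.2.1.preimage hWO, ?_⟩
  rintro _ ⟨x, hx, rfl⟩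
  refine ((hW.2.2 ⟨x, hx⟩).preimage hO.injOn).subset ?_
  rintro n ⟨h1, h2⟩
  exact ⟨h1, h2⟩

end Towers

/-! ### Counting the tasks and the transfinite recursion -/

theorem mk_opens_le_continuum {X : Type} [TopologicalSpace X] [SecondCountableTopology X] :
    #(TopologicalSpace.Opens X) ≤ 𝔠 := by
  let B := TopologicalSpace.countableBasis X
  have hB := TopologicalSpace.isBasis_countableBasis X
  have hinj : Function.Injective
      fun U : TopologicalSpace.Opens X => {b : B | (b : Set X) ⊆ U} := by
    have hle : ∀ U V : TopologicalSpace.Opens X,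
        {b : B | (b : Set X) ⊆ U} = {b : B | (b : Set X) ⊆ V} → U ≤ V := by
      intro U V h x hx
      obtain ⟨b, hbB, hxb, hbU⟩ := hB.exists_subset_of_mem_open hx U.isOpen
      have : (⟨b, hbB⟩ : B) ∈ {b : B | (b : Set X) ⊆ V} := h ▸ hbU
      exact this hxb
    exact fun U V h => le_antisymm (hle U V h) (hle V U h.symm)
  have hBc : #B ≤ ℵ₀ := Cardinal.le_aleph0_iff_set_countable.2
    (TopologicalSpace.countable_countableBasis X)
  refine (Cardinal.mk_le_of_injective hinj).trans ?_
  rw [Cardinal.mk_set, ← Cardinal.two_power_aleph0]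
  exact Cardinal.power_le_power_left two_ne_zero hBc

/-- The points which code finite sets, cofinite sets, and members of `S`. -/
def pointsOver (S : Set (Set ℕ)) : Set (ℕ → Bool) :=
  {z | (toSet z).Finite ∨ (toSet z)ᶜ.Finite ∨ toSet z ∈ S}

theorem pointsOver_mono {S S' : Set (Set ℕ)} (h : S ⊆ S') : pointsOver S ⊆ pointsOver S' :=
  fun _ hz => hz.imp_right fun hz => hz.imp_right fun hz => h hz

theorem mk_pointsOver_lt {S : Set (Set ℕ)} (hS : #S < 𝔠) : #(pointsOver S) < 𝔠 := by
  let K : Set (Set ℕ) := {A | A.Finite} ∪ {A | Aᶜ.Finite}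
  have hK : K.Countable :=
    Countable.ofPred_finite.union (Countable.ofPred_finite.preimage compl_injective)
  have hle : #(pointsOver S) ≤ #(K ∪ S : Set (Set ℕ)) := by
    refine Cardinal.mk_le_of_injective (f := fun z => ⟨toSet z.1, ?_⟩) fun x y h => ?_
    · rcases z.2 with h | h | h
      · exact Or.inl (Or.inl h)
      · exact Or.inl (Or.inr h)
      · exact Or.inr h
    · exact Subtype.ext (toSet_injective (congrArg Subtype.val h))
  exact hle.trans_lt ((Cardinal.mk_union_le _ _).trans_lt
    (Cardinal.add_lt_of_lt Cardinal.aleph0_le_continuum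
      ((Cardinal.le_aleph0_iff_set_countable.2 hK).trans_lt Cardinal.aleph0_lt_continuum) hS))

/-- A matrix of open subsets of the Cantor space, together with a function. -/
abbrev Task : Type :=
  (ℕ → ℕ → TopologicalSpace.Opens (ℕ → Bool)) × (ℕ → ℕ)

theorem mk_task_le_continuum : #Task ≤ 𝔠 := by
  have h1 : #(ℕ → ℕ → TopologicalSpace.Opens (ℕ → Bool)) ≤ 𝔠 := by
    rw [← Cardinal.power_def, ← Cardinal.power_def, Cardinal.mk_nat]
    calc ((#(TopologicalSpace.Opens (ℕ → Bool))) ^ ℵ₀) ^ ℵ₀ ≤ (𝔠 ^ ℵ₀) ^ ℵ₀ :=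
          Cardinal.power_le_power_right (Cardinal.power_le_power_right mk_opens_le_continuum)
      _ = 𝔠 := by rw [Cardinal.continuum_power_aleph0, Cardinal.continuum_power_aleph0]
  have h2 : #(ℕ → ℕ) ≤ 𝔠 := by
    rw [← Cardinal.power_def, Cardinal.mk_nat, Cardinal.aleph0_power_aleph0]
  rw [Cardinal.mk_prod, Cardinal.lift_id, Cardinal.lift_id, ← Cardinal.continuum_mul_self]
  exact mul_le_mul' h1 h2

/-- `b` continues the tower `S` and fulfils the task `t`. -/
def Fulfils (t : Task) (S : Set (Set ℕ)) (b : Set ℕ) : Prop :=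
  b.Infinite ∧ (∀ A ∈ S, AlmostSubset b A) ∧ (∀ n, t.2 n ≤ enumeration b n) ∧
    (RowsOmegaCover (fun n m => (t.1 n m : Set (ℕ → Bool))) (pointsOver S) →
      ∃ f : ℕ → ℕ, ∀ z, (z ∈ pointsOver S ∨ AlmostSubset (toSet z) b) →
        ∀ᶠ n in atTop, z ∈ t.1 n (f n))

theorem exists_fulfils (hpc : pseudoIntersectionNumber = 𝔠) (t : Task) {S : Set (Set ℕ)}
    (hS : #S < 𝔠) (hinf : ∀ A ∈ S, A.Infinite)
    (hchain : ∀ A ∈ S, ∀ B ∈ S, AlmostSubset A B ∨ AlmostSubset B A) : ∃ b, Fulfils t S b := by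
  obtain ⟨P, hP, hPS⟩ := exists_pseudoIntersection (hpc.symm ▸ hS) (fun A : S => A.1) (by
    intro s
    rcases s.eq_empty_or_nonempty with rfl | hs
    · simpa using infinite_univ
    · exact infinite_inter_of_chain (fun A : S => hinf A A.2)
        (fun A B => hchain A A.2 B B.2) hs)
  obtain ⟨a, haP, ha, hag⟩ := exists_subset_enumeration_ge hP t.2
  have hsub : ∀ b ⊆ a, ∀ A ∈ S, AlmostSubset b A := fun b hb A hA =>
    (AlmostSubset.of_subset (hb.trans haP)).trans (hPS ⟨A, hA⟩)
  by_cases hU : RowsOmegaCover (fun n m => (t.1 n m : Set (ℕ → Bool))) (pointsOver S)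
  · obtain ⟨b, hba, hb, hf⟩ := exists_subset_selection hpc (fun n m => (t.1 n m).isOpen)
      (mk_pointsOver_lt hS) (fun z hz => Or.inl hz) hU ha
    exact ⟨b, hb, hsub b hba, hag b hba hb, fun _ => hf⟩
  · exact ⟨a, ha, hsub a subset_rfl, hag a subset_rfl ha, fun h => absurd h hU⟩

/-- The tower obtained by fulfilling all tasks in the order `r`. -/
theorem exists_tower_fulfilling (hpc : pseudoIntersectionNumber = 𝔠) :
    ∃ (r : Task → Task → Prop) (_ : IsWellOrder Task r) (x : Task → Set ℕ),
      ∀ t, Fulfils t (x '' {s | r s t}) (x t) := by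
  classical
  -- The well-order has least possible type, so proper initial segments have size below `𝔠`.
  obtain ⟨r, hr, hord⟩ := Cardinal.exists_ord_eq Task
  have wf : WellFounded r := hr.wf
  let step : (t : Task) → ((s : Task) → r s t → Set ℕ) → Set ℕ := fun t ih =>
    -- The value `∅` never occurs: the induction below shows that a suitable `b` always exists.
    if h : ∃ b, Fulfils t {A | ∃ s, ∃ hs : r s t, ih s hs = A} b then h.choose else ∅
  let x : Task → Set ℕ := wf.fix step
  have hx : ∀ t, (∃ b, Fulfils t (x '' {s | r s t}) b) → Fulfils t (x '' {s | r s t}) (x t) := by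
    intro t h
    have hS : {A | ∃ s, ∃ _ : r s t, x s = A} = x '' {s | r s t} := by
      ext A; simp
    rw [← hS] at h ⊢
    have : x t = h.choose := (wf.fix_eq step t).trans (dif_pos h)
    rw [this]
    exact h.choose_spec
  refine ⟨r, hr, x, fun t => ?_⟩
  induction t using wf.induction with
  | _ t ih =>
  have hcard : #{s | r s t} < 𝔠 :=
    (Ordinal.card_typein (r := r) t ▸ Cardinal.card_typein_lt t hord).trans_le mk_task_le_continuum
  refine hx t (exists_fulfils hpc t (Cardinal.mk_image_le.trans_lt hcard) ?_ ?_)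
  · rintro _ ⟨s, hs, rfl⟩
    exact (ih s hs).1
  · rintro _ ⟨s, hs, rfl⟩ _ ⟨s', hs', rfl⟩
    rcases trichotomous_of r s s' with h | rfl | h
    · exact Or.inr ((ih s' hs').2.1 _ ⟨s, h, rfl⟩)
    · exact Or.inl (AlmostSubset.refl _)
    · exact Or.inl ((ih s hs).2.1 _ ⟨s', h, rfl⟩)

/-! ### Properties of the constructed set -/

section Fulfilling

variable {r : Task → Task → Prop} {x : Task → Set ℕ}

theorem mem_pointsOver_diff_finSets (hx : ∀ t, Fulfils t (x '' {s | r s t}) (x t))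
    {z : ℕ → Bool} :
    z ∈ pointsOver (range x) \ finSets ↔ (toSet z)ᶜ.Finite ∨ toSet z ∈ range x := by
  constructor
  · rintro ⟨h | h, hz⟩
    · exact absurd h hz
    · exact h
  · intro h
    refine ⟨Or.inr h, fun hz : (toSet z).Finite => ?_⟩
    rcases h with h | ⟨t, ht⟩
    · exact infinite_univ (union_compl_self (toSet z) ▸ hz.union h)
    · exact (hx t).1 (ht ▸ hz)

theorem isDominating_pointsOver (hx : ∀ t, Fulfils t (x '' {s | r s t}) (x t)) :
    IsDominating ((fun z => enumeration (toSet z)) '' (pointsOver (range x) \ finSets)) := by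
  intro g
  obtain ⟨z, hz⟩ := toSet_surjective (x (fun _ _ => ⊥, g))
  refine ⟨_, ⟨z, (mem_pointsOver_diff_finSets hx).2 (Or.inr ⟨_, hz.symm⟩), rfl⟩,
    Eventually.of_forall fun n => ?_⟩
  simp only [hz]
  exact (hx (fun _ _ => ⊥, g)).2.2.1 n

variable [IsWellOrder Task r]

theorem S1_pointsOver (hx : ∀ t, Fulfils t (x '' {s | r s t}) (x t)) :
    S1 (openOmegaCovers (pointsOver (range x))) (openGammaCovers (pointsOver (range x))) := by
  intro U hU
  have hne : ∀ n, (U n).Nonempty := fun n => by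
    obtain ⟨V, hV, -⟩ := (hU n).2.2.2 ∅ finite_empty
    exact ⟨V, hV⟩
  choose u hu using fun n => (hU n).1.exists_eq_range (hne n)
  have huU : ∀ n m, u n m ∈ U n := fun n m => hu n ▸ mem_range_self m
  choose O hOo hO using fun n m => isOpen_induced_iff.1 ((hU n).2.1 _ (huU n m))
  let t : Task := (fun n m => ⟨O n m, hOo n m⟩, 0)
  have hsub : pointsOver (x '' {s | r s t}) ⊆ pointsOver (range x) :=
    pointsOver_mono (image_subset_range _ _)
  obtain ⟨f, hf⟩ := (hx t).2.2.2 (by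
    intro n F hF hFf
    obtain ⟨V, hV, hFV⟩ := (hU n).2.2.2 (Subtype.val ⁻¹' F)
      (hFf.preimage Subtype.val_injective.injOn)
    rw [hu n] at hV
    obtain ⟨m, rfl⟩ := hV
    refine ⟨m, fun z hz => ?_⟩
    have : (⟨z, hsub (hF hz)⟩ : pointsOver (range x)) ∈ u n m := hFV hz
    rw [← hO n m] at this
    exact this)
  refine ⟨fun n => u n (f n), fun n => huU n _, range_mem_openGammaCovers
    (fun n => (hU n).2.1 _ (huU n _)) (fun n h => (hU n).2.2.1.2 (h ▸ huU n _)) fun z => ?_⟩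
  -- Points from stages before `t` were present already; the sets from stage `t` on are almost
  -- contained in `x t`.
  have hz : z.1 ∈ pointsOver (x '' {s | r s t}) ∨ AlmostSubset (toSet z.1) (x t) := by
    rcases z.2 with h | h | ⟨s, hs⟩
    · exact Or.inl (Or.inl h)
    · exact Or.inl (Or.inr (Or.inl h))
    · rcases trichotomous_of r s t with h | rfl | h
      · exact Or.inl (Or.inr (Or.inr ⟨s, h, hs⟩))
      · exact Or.inr (hs ▸ AlmostSubset.refl _)
      · exact Or.inr (hs ▸ (hx s).2.1 _ ⟨t, h, rfl⟩)
  filter_upwards [hf z hz] with n hn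
  rw [← hO]
  exact hn

/-- A cofinite set almost contains everything; a subfamily without one has its `r`-first member as
the largest. -/
theorem isTower_pointsOver (hx : ∀ t, Fulfils t (x '' {s | r s t}) (x t)) :
    IsTower (toSet '' (pointsOver (range x) \ finSets)) := by
  refine ⟨?_, fun S hS hSne => ?_, (isDominating_pointsOver hx).not_exists_pseudoIntersection⟩
  · rintro _ ⟨z, hz, rfl⟩
    exact hz.2
  · have hS' : ∀ A ∈ S, Aᶜ.Finite ∨ A ∈ range x := by
      intro A hA
      obtain ⟨z, hz, rfl⟩ := hS hA
      exact (mem_pointsOver_diff_finSets hx).1 hz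
    by_cases hcof : ∃ A ∈ S, Aᶜ.Finite
    · obtain ⟨A, hA, hAf⟩ := hcof
      exact ⟨A, hA, fun B _ => hAf.subset fun n hn => hn.2⟩
    · push Not at hcof
      have hSx : ∀ A ∈ S, ∃ t, x t = A := fun A hA => (hS' A hA).resolve_left (hcof A hA)
      have wf : WellFounded r := IsWellFounded.wf
      obtain ⟨A, hA⟩ := hSne
      obtain ⟨t, rfl⟩ := hSx A hA
      obtain ⟨t, ht, hmin⟩ := wf.has_min (x ⁻¹' S) ⟨t, hA⟩
      refine ⟨x t, ht, fun B hB => ?_⟩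
      obtain ⟨s, rfl⟩ := hSx B hB
      rcases trichotomous_of r s t with h | rfl | h
      · exact absurd h (hmin s hB)
      · exact AlmostSubset.refl _
      · exact (hx s).2.1 _ ⟨t, h, rfl⟩

end Fulfilling

end SelectionPrinciples

theorem mainTheorem3 (hpc : SelectionPrinciples.pseudoIntersectionNumber = Cardinal.continuum) :
    ∃ X : Set (ℕ → Bool),
      SelectionPrinciples.finSets ⊆ X ∧
      SelectionPrinciples.S1 (SelectionPrinciples.openOmegaCovers X)
        (SelectionPrinciples.openGammaCovers X) ∧
      SelectionPrinciples.IsTauSet X ∧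
      ¬ SelectionPrinciples.Ufin
        (SelectionPrinciples.openGammaCovers ↥(X \ SelectionPrinciples.finSets))
        (SelectionPrinciples.openCovers ↥(X \ SelectionPrinciples.finSets)) ∧
      ¬ SelectionPrinciples.IsTauSet ↥(X \ SelectionPrinciples.finSets) ∧
      SelectionPrinciples.IsTower
        (SelectionPrinciples.toSet '' (X \ SelectionPrinciples.finSets)) ∧
      SelectionPrinciples.IsDominating
        ((fun x => SelectionPrinciples.enumeration (SelectionPrinciples.toSet x)) ''
          (X \ SelectionPrinciples.finSets)) := by
  obtain ⟨r, hr, x, hx⟩ := SelectionPrinciples.exists_tower_fulfilling hpc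
  have hfin : SelectionPrinciples.finSets ⊆ SelectionPrinciples.pointsOver (Set.range x) :=
    fun z hz => Or.inl hz
  have hS1 := SelectionPrinciples.S1_pointsOver hx
  have htower := SelectionPrinciples.isTower_pointsOver hx
  have hdom := SelectionPrinciples.isDominating_pointsOver hx
  have hcof : ∀ z, (SelectionPrinciples.toSet z)ᶜ.Finite →
      z ∈ SelectionPrinciples.pointsOver (Set.range x) \ SelectionPrinciples.finSets :=
    fun z hz => (SelectionPrinciples.mem_pointsOver_diff_finSets hx).2 (Or.inl hz)
  have hne : Nonempty (SelectionPrinciples.pointsOver (Set.range x)) :=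
    ⟨⟨fun _ => false, hfin (by simp [SelectionPrinciples.finSets, SelectionPrinciples.toSet])⟩⟩
  exact ⟨_, hfin, hS1, SelectionPrinciples.isTauSet_of_S1 hS1,
    SelectionPrinciples.not_Ufin_of_isDominating (fun z hz => hz.2) hcof hdom,
    SelectionPrinciples.not_isTauSet_of_isTower htower hcof, htower, hdom⟩
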